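/- Let $h:\mathbb{R}\to\mathbb{R}$ be a $C^\infty$ even function, non-increasing on $[0,\infty)$, with $h(t)=1$ for $|t|\le 1/2$ and $h(t)=0$ for $|t|\ge 1$. Let $(\mathbb{M},\rho)$ be a compact metric space of diameter $\pi$; denote by $\mathbb{B}(x,r)$ the closed ball of radius $r$ centered at $x$, and for $K\subseteq\mathbb{M}$ let $\mathbb{B}(K,r)=\{x\in\mathbb{M}:\inf_{y\in K}\rho(x,y)\le r\}$. Let $\mu$ be a Borel probability measure on $\mathbb{M}$ with support $\mathbb{X}$, and assume that $\mu$ is detectable with parameters $\alpha,\kappa_1\ge 0$, $\kappa_2>0$, $0<r_0\le\pi$, that is, $$\mu(\mathbb{B}(x,r))\le\kappa_1 r^\alpha\quad (x\in\mathbb{M},\ 0<r\le\pi),\qquad \mu(\mathbb{B}(x,r))\ge\kappa_2 r^\alpha\quad (x\in\mathbb{X},\ 0<r\le r_0).$$ Define $$\Psi_n(x,y)=\Bigl\{\sum_{\ell=-n}^{n}h\Bigl(\frac{\ell}{n}\Bigr)e^{i\ell\rho(x,y)}\Bigr\}^2,$$ which is real and nonnegative, and for points $x_1,\dots,x_M\in\mathbb{M}$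 and $\Theta>0$ let $$F_n(x)=\frac1M\sum_{j=1}^M\Psi_n(x,x_j),\qquad \mathcal{G}_n(\Theta)=\Bigl\{x\in\mathbb{M}:F_n(x)\ge\Theta\max_{1\le k\le M}F_n(x_k)\Bigr\}.$$ Let $S>\alpha$. Then there exist constants $A,c_1,c_2,a,b>0$ and $0<C<1$, and a function $r$ satisfying $$a\,\Theta^{-1/(S-\alpha)}\le r(\Theta)\le b\,\Theta^{-1/(S-\alpha)}\qquad(0<\Theta<C),$$ all depending only on $h,S,\alpha,\kappa_1,\kappa_2,r_0$ (and not on $\mathbb{M}$ or $\mu$ otherwise), with the following property. For all $0<\Theta<C$ and all integers $n,M\ge 1$ with $M\ge A\,n^\alpha\log n$, if $x_1,\dots,x_M$ are independent samples from $\mu$, then with probability at least $1-c_1/M^{c_2}$, $$\mathbb{X}\subseteq\mathcal{G}_n(\Theta)\subseteq\mathbb{B}\bigl(\mathbb{X},r(\Theta)/n\bigr).$$ -/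

import Mathlib

open MeasureTheory ProbabilityTheory


/-- A low pass filter: a smooth even function on the line, equal to one on `[-1/2, 1/2]`, vanishing
outside `(-1, 1)`, and non-increasing on `[0, ∞)`. -/
structure IsLowPassFilter (h : ℝ → ℝ) : Prop where
  contDiff : ContDiff ℝ ((⊤ : ℕ∞) : WithTop ℕ∞) h
  even : ∀ t, h (-t) = h t
  eq_one : ∀ t, |t| ≤ 1 / 2 → h t = 1
  eq_zero : ∀ t, 1 ≤ |t| → h t = 0
  antitoneOn : AntitoneOn h (Set.Ici 0)

/-- A measure on a metric space is detectable with parameters `α, κ₁, κ₂, r₀` if closed balls of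
radius `r ≤ π` have measure at most `κ₁ r ^ α`, and closed balls of radius `r ≤ r₀` centered at
points of the support have measure at least `κ₂ r ^ α`. -/
structure IsDetectable {E : Type*} [MetricSpace E] [MeasurableSpace E]
    (μ : Measure E) (α κ₁ κ₂ r₀ : ℝ) : Prop where
  exponent_nonneg : 0 ≤ α
  upper_const_nonneg : 0 ≤ κ₁
  lower_const_pos : 0 < κ₂
  radius_pos : 0 < r₀
  radius_le : r₀ ≤ Real.pi
  measure_closedBall_le : ∀ x : E, ∀ r : ℝ, 0 < r → r ≤ Real.pi →
    μ (Metric.closedBall x r) ≤ ENNReal.ofReal (κ₁ * r ^ α)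
  le_measure_closedBall : ∀ x ∈ μ.support, ∀ r : ℝ, 0 < r → r ≤ r₀ →
    ENNReal.ofReal (κ₂ * r ^ α) ≤ μ (Metric.closedBall x r)

/-- The localized kernel `Ψ_n(x, y) = (∑_{|ℓ| ≤ n} h(ℓ / n) exp(i ℓ ρ(x, y))) ^ 2`. -/
noncomputable def localizedKernel {E : Type*} [MetricSpace E] (h : ℝ → ℝ) (n : ℕ) (x y : E) : ℂ :=
  (∑ l ∈ Finset.Icc (-(n : ℤ)) (n : ℤ),
    (h ((l : ℝ) / (n : ℝ)) : ℂ) * Complex.exp (Complex.I * ((l : ℝ) : ℂ) * (dist x y : ℂ))) ^ 2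

/-- The support estimator `F_n(x) = (1 / M) ∑_j Ψ_n(x, x_j)`. For an even `h` the kernel is real and
nonnegative (see `localizedKernel_eq_sq`), so that taking real parts loses nothing. -/
noncomputable def supportEstimator {E : Type*} [MetricSpace E] (h : ℝ → ℝ) (n : ℕ) {M : ℕ}
    (x : Fin M → E) (z : E) : ℝ :=
  (1 / (M : ℝ)) * ∑ j : Fin M, (localizedKernel h n z (x j)).re

/-- The support estimator set
`G_n(Θ) = {z : F_n(z) ≥ Θ * max_k F_n(x_k)}`. -/
noncomputable def supportEstimatorSet {E : Type*} [MetricSpace E] (h : ℝ → ℝ) (n : ℕ) {M : ℕ}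
    (x : Fin M → E) (Θ : ℝ) : Set E :=
  {z | Θ * (⨆ k : Fin M, supportEstimator h n x (x k)) ≤ supportEstimator h n x z}

/-- For an even `h`, the kernel is the square of a real number. -/
theorem localizedKernel_eq_sq {E : Type*} [MetricSpace E] {h : ℝ → ℝ} (heven : ∀ t, h (-t) = h t)
    (n : ℕ) (x y : E) :
    localizedKernel h n x y = (((∑ l ∈ Finset.Icc (-(n : ℤ)) (n : ℤ),
      h ((l : ℝ) / (n : ℝ)) * Real.cos ((l : ℝ) * dist x y)) ^ 2 : ℝ) : ℂ) := by
  have hsin : ∑ l ∈ Finset.Icc (-(n : ℤ)) (n : ℤ),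
      h ((l : ℝ) / (n : ℝ)) * Real.sin ((l : ℝ) * dist x y) = 0 := by
    have key : ∑ l ∈ Finset.Icc (-(n : ℤ)) (n : ℤ),
        h ((l : ℝ) / (n : ℝ)) * Real.sin ((l : ℝ) * dist x y) =
        ∑ l ∈ Finset.Icc (-(n : ℤ)) (n : ℤ),
        -(h ((l : ℝ) / (n : ℝ)) * Real.sin ((l : ℝ) * dist x y)) := by
      refine Finset.sum_bij' (fun l _ => -l) (fun l _ => -l) ?_ ?_ ?_ ?_ ?_
      · intro l hl
        simp only [Finset.mem_Icc] at hl ⊢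
        omega
      · intro l hl
        simp only [Finset.mem_Icc] at hl ⊢
        omega
      · simp
      · simp
      · intro l _
        rw [Int.cast_neg, neg_div, heven, neg_mul, Real.sin_neg]
        ring
    rw [Finset.sum_neg_distrib] at key
    linarith
  unfold localizedKernel
  rw [Complex.ofReal_pow]
  congr 1
  have hterm : ∀ l ∈ Finset.Icc (-(n : ℤ)) (n : ℤ),
      (h ((l : ℝ) / (n : ℝ)) : ℂ) * Complex.exp (Complex.I * ((l : ℝ) : ℂ) * (dist x y : ℂ)) =
      ((h ((l : ℝ) / (n : ℝ)) * Real.cos ((l : ℝ) * dist x y) : ℝ) : ℂ) +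
      ((h ((l : ℝ) / (n : ℝ)) * Real.sin ((l : ℝ) * dist x y) : ℝ) : ℂ) * Complex.I := by
    intro l _
    rw [show Complex.I * ((l : ℝ) : ℂ) * (dist x y : ℂ) =
      (((l : ℝ) * dist x y : ℝ) : ℂ) * Complex.I by push_cast; ring, Complex.exp_mul_I]
    push_cast
    ring
  rw [Finset.sum_congr rfl hterm, Finset.sum_add_distrib, ← Finset.sum_mul, ← Complex.ofReal_sum,
    ← Complex.ofReal_sum, hsin]
  simp

/-! The kernel behaves like a bump of height `n ^ 2` and width `1 / n`: it is at least `n ^ 2 / 4`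
where `n * dist ≤ 1` (`localizedKernel_re_ge`), and at most a constant times `n ^ 2 * min 1 ((n *
dist) ^ (-S))` (`exists_localizedKernel_re_le`), the decay coming from repeated summation by parts.

With high probability the sample counts match the measure at all scales from `1 / n` up
(`measureReal_compl_counts_le`): Chernoff bounds hold at the points of a net of the support with
mesh comparable to `1 / n`, and a packing argument carries them to all balls. The net has at most
order `n ^ α` points, and `M ≥ A n ^ α log n` lets the exponential absorb the union bound.

Given such counts, everything is deterministic. The estimator is at least of order `n ^ (2 - α)` on
the support, at most of that order everywhere, and smaller by a factor `R ^ (-(S - α))` beyond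
distance `R / n`, by summing over dyadic shells. A small `Θ` gives the first inclusion; taking `R` a
large multiple of `Θ ^ (-1 / (S - α))` gives the second (`supportEstimatorSet_inclusions`). -/

/-! ### Localization of the kernel by summation by parts. -/

theorem deriv_fwdDiff_iter {f : ℝ → ℝ} (hf : ContDiff ℝ ((⊤ : ℕ∞) : WithTop ℕ∞) f) (s : ℝ) (Q : ℕ) :
    ContDiff ℝ ((⊤ : ℕ∞) : WithTop ℕ∞) ((fwdDiff s)^[Q] f) ∧
      deriv ((fwdDiff s)^[Q] f) = (fwdDiff (s))^[Q] (deriv f) := by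
  induction Q with
  | zero => exact ⟨hf, rfl⟩
  | succ Q ih =>
    obtain ⟨h1, h2⟩ := ih
    rw [Function.iterate_succ_apply', Function.iterate_succ_apply', ← h2]
    set g := (fwdDiff s)^[Q] f
    have hd : Differentiable ℝ g := h1.differentiable (by simp)
    refine ⟨(h1.comp (contDiff_id.add contDiff_const)).sub h1, ?_⟩
    ext x
    have hx : HasDerivAt (fun y => g (y + s)) (deriv g (x + s)) x :=
      HasDerivAt.comp_add_const x s (hd _).hasDerivAt
    exact (hx.sub (hd x).hasDerivAt).deriv

/-- Iterated forward differences of a smooth compactly supported function are controlled by the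
corresponding power of the step. -/
theorem exists_abs_fwdDiff_iter_le (Q : ℕ) : ∀ f : ℝ → ℝ, ContDiff ℝ ((⊤ : ℕ∞) : WithTop ℕ∞) f →
    HasCompactSupport f → ∃ B : ℝ, 0 ≤ B ∧ ∀ s x : ℝ, |((fwdDiff s)^[Q] f) x| ≤ B * |s| ^ Q := by
  induction Q with
  | zero =>
    intro f hf hc
    obtain ⟨B, hB⟩ := hf.continuous.bounded_above_of_compact_support hc
    exact ⟨B, (norm_nonneg _).trans (hB 0), fun s x => by simpa using hB x⟩
  | succ Q ih =>
    intro f hf hc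
    -- Differencing commutes with `deriv`, so the bound for `deriv f` bounds the derivative of the
    -- `Q`-th difference; the mean value inequality over one step supplies the extra `|s|`.
    obtain ⟨B, hB0, hB⟩ := ih (deriv f) (by
      simpa using (contDiff_infty_iff_deriv.1 hf).2) hc.deriv
    refine ⟨B, hB0, fun s x => ?_⟩
    obtain ⟨h1, h2⟩ := deriv_fwdDiff_iter hf s Q
    rw [Function.iterate_succ_apply']
    have := Convex.norm_image_sub_le_of_norm_deriv_le (f := (fwdDiff s)^[Q] f) (s := Set.univ)
      (C := B * |s| ^ Q) (x := x) (y := x + s)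
      (fun y _ => (h1.differentiable (by simp)) y)
      (fun y _ => by rw [h2]; exact hB s y) convex_univ trivial trivial
    rw [add_sub_cancel_left] at this
    rw [pow_succ, ← mul_assoc]
    exact this

/-- Iterated summation by parts for finitely supported sequences. -/
theorem summation_by_parts_iter (w : ℂ) (hw : w ≠ 0) (g : ℤ → ℝ) (Q : ℕ) (n : ℤ) (hn : 0 ≤ n)
    (hg : ∀ l : ℤ, n ≤ |l| → g l = 0) :
    (∀ l : ℤ, (l ≤ -n - Q ∨ n ≤ l) → ((fwdDiff (1 : ℤ))^[Q] g) l = 0) ∧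
    ∑' l : ℤ, ((((fwdDiff (1 : ℤ))^[Q] g) l : ℝ) : ℂ) * w ^ l =
      (w⁻¹ - 1) ^ Q * ∑' l : ℤ, (g l : ℂ) * w ^ l := by
  induction Q with
  | zero =>
    refine ⟨fun l hl => ?_, by simp⟩
    apply hg
    rcases hl with hl | hl
    · rw [abs_of_nonpos (by simp at hl; omega)]; simp at hl; omega
    · exact hl.trans (le_abs_self _)
  | succ Q ih =>
    obtain ⟨h0, h1⟩ := ih
    rw [Function.iterate_succ_apply']
    set G := (fwdDiff (1 : ℤ))^[Q] g
    -- A forward difference looks only to the right, so the support grows by one place on the left;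
    -- this is the asymmetric range `-n - Q`.
    refine ⟨fun l hl => ?_, ?_⟩
    · have e : (fwdDiff (1 : ℤ) G) l = G (l + 1) - G l := rfl
      rw [e, h0, h0]
      · simp
      · push_cast at hl; omega
      · push_cast at hl; omega
    · have hs : Summable (fun l : ℤ => (G l : ℂ) * w ^ l) := by
        apply summable_of_ne_finset_zero (s := Finset.Icc (-n - Q) n)
        intro l hl
        rw [h0 l (by simp at hl; omega)]; simp
      have hs' : Summable (fun l : ℤ => (G (l + 1) : ℂ) * w ^ (l + 1)) :=
        ((Equiv.addRight (1 : ℤ)).summable_iff (f := fun l : ℤ => (G l : ℂ) * w ^ l)).2 hs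
      have he : ∑' l : ℤ, (G (l + 1) : ℂ) * w ^ (l + 1) = ∑' l : ℤ, (G l : ℂ) * w ^ l :=
        (Equiv.addRight (1 : ℤ)).tsum_eq (fun l : ℤ => (G l : ℂ) * w ^ l)
      have : ∀ l : ℤ, (((fwdDiff (1 : ℤ) G) l : ℝ) : ℂ) * w ^ l =
          w⁻¹ * ((G (l + 1) : ℂ) * w ^ (l + 1)) - (G l : ℂ) * w ^ l := by
        intro l
        have e : (fwdDiff (1 : ℤ) G) l = G (l + 1) - G l := rfl
        rw [e, zpow_add_one₀ hw]
        push_cast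
        field_simp
      rw [tsum_congr this, (hs'.mul_left _).tsum_sub hs, tsum_mul_left, he, h1, pow_succ]
      ring

/-- Turns unit differences of the coefficients into differences of the filter with step `1 / n`,
hence of size `n ^ (-Q)`. -/
theorem fwdDiff_iter_comp_div (h : ℝ → ℝ) (n : ℝ) (Q : ℕ) (l : ℤ) :
    ((fwdDiff (1 : ℤ))^[Q] (fun l : ℤ => h (l / n))) l = ((fwdDiff (1 / n))^[Q] h) (l / n) := by
  induction Q generalizing l with
  | zero => rfl
  | succ Q ih =>
    rw [Function.iterate_succ_apply', Function.iterate_succ_apply', fwdDiff, fwdDiff, ih, ih]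
    push_cast
    rw [add_div]

namespace IsLowPassFilter

variable {h : ℝ → ℝ}

theorem hasCompactSupport (hh : IsLowPassFilter h) : HasCompactSupport h := by
  apply HasCompactSupport.intro (isCompact_Icc (a := (-1 : ℝ)) (b := 1))
  intro x hx
  apply hh.eq_zero
  by_contra hc
  exact hx (abs_le.1 (not_le.1 hc).le)

theorem nonneg (hh : IsLowPassFilter h) (t : ℝ) : 0 ≤ h t := by
  have key : ∀ t, 0 ≤ t → 0 ≤ h t := by
    intro t ht
    rw [← hh.eq_zero (max t 1) ((le_max_right t 1).trans (le_abs_self _))]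
    exact hh.antitoneOn ht (ht.trans (le_max_left _ _)) (le_max_left _ _)
  rcases le_total 0 t with ht | ht
  · exact key t ht
  · rw [← hh.even]; exact key _ (by linarith)

/-- Localization of the trigonometric kernel. -/
theorem exists_norm_sum_le (hh : IsLowPassFilter h) (Q : ℕ) : ∃ D : ℝ, 0 ≤ D ∧
    ∀ n : ℕ, 1 ≤ n → ∀ t : ℝ, 0 ≤ t → t ≤ Real.pi →
      (n * t) ^ Q * ‖∑ l ∈ Finset.Icc (-(n : ℤ)) (n : ℤ),
        (h ((l : ℝ) / (n : ℝ)) : ℂ) * Complex.exp (Complex.I * ((l : ℝ) : ℂ) * (t : ℂ))‖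
        ≤ D * n := by
  obtain ⟨B, hB0, hB⟩ := exists_abs_fwdDiff_iter_le Q h hh.contDiff hh.hasCompactSupport
  -- `(π / 2) ^ Q` inverts the lower bound on `‖w⁻¹ - 1‖`; `(Q + 3) * n` bounds the number `2 * n +
  -- Q + 1` of nonzero terms.
  refine ⟨(Real.pi / 2) ^ Q * ((Q + 3) * B), by positivity, fun n hn t ht0 htpi => ?_⟩
  have hn' : (0 : ℝ) < n := by exact_mod_cast hn
  set w : ℂ := Complex.exp (Complex.I * t) with hw
  have hw0 : w ≠ 0 := Complex.exp_ne_zero _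
  have hwn : ‖w‖ = 1 := Complex.norm_exp_I_mul_ofReal t
  set g : ℤ → ℝ := fun l => h (l / (n : ℝ)) with hg
  have hgz : ∀ l : ℤ, (n : ℤ) ≤ |l| → g l = 0 := by
    intro l hl
    apply hh.eq_zero
    rw [abs_div, Nat.abs_cast, one_le_div hn']
    exact_mod_cast hl
  obtain ⟨h0, h1⟩ := summation_by_parts_iter w hw0 g Q n (by positivity) hgz
  have hsum : ∑ l ∈ Finset.Icc (-(n : ℤ)) (n : ℤ),
      (h ((l : ℝ) / (n : ℝ)) : ℂ) * Complex.exp (Complex.I * ((l : ℝ) : ℂ) * (t : ℂ)) =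
      ∑' l : ℤ, (g l : ℂ) * w ^ l := by
    rw [tsum_eq_sum (s := Finset.Icc (-(n : ℤ)) (n : ℤ))]
    · refine Finset.sum_congr rfl fun l _ => ?_
      rw [hw, ← Complex.exp_int_mul]
      congr 2
      push_cast
      ring
    · intro l hl
      rw [hgz l (by rw [Finset.mem_Icc] at hl; rw [le_abs']; omega)]
      simp
  rw [hsum]
  -- The chord has length `2 sin (t / 2)`, and Jordan's inequality applies because `t ≤ π`.
  have hlow : 2 / Real.pi * t ≤ ‖w⁻¹ - 1‖ := by
    have : ‖w⁻¹ - 1‖ = ‖w - 1‖ := by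
      have e : w⁻¹ - 1 = -(w⁻¹ * (w - 1)) := by field_simp; ring
      rw [e, norm_neg, norm_mul, norm_inv, hwn]; simp
    rw [this, hw, Complex.norm_exp_I_mul_ofReal_sub_one, norm_mul, Real.norm_eq_abs,
      Real.norm_eq_abs, abs_two]
    have := Real.mul_le_sin (x := t / 2) (by linarith) (by linarith)
    have h3 := le_abs_self (Real.sin (t / 2))
    calc 2 / Real.pi * t = 2 * (2 / Real.pi * (t / 2)) := by ring
      _ ≤ _ := by linarith
  have hup : ‖∑' l : ℤ, ((((fwdDiff (1 : ℤ))^[Q] g) l : ℝ) : ℂ) * w ^ l‖ ≤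
      ((Q + 3) * n) * (B * (1 / (n : ℝ)) ^ Q) := by
    rw [tsum_eq_sum (s := Finset.Icc (-(n : ℤ) - Q) (n : ℤ))]
    · refine (norm_sum_le_of_le _ (n := fun _ => B * (1 / (n : ℝ)) ^ Q) ?_).trans ?_
      · intro l _
        rw [norm_mul, norm_zpow, hwn, one_zpow, mul_one, Complex.norm_real, Real.norm_eq_abs, hg,
          fwdDiff_iter_comp_div]
        simpa [abs_of_pos hn'] using hB (1 / (n : ℝ)) (l / (n : ℝ))
      · rw [Finset.sum_const, nsmul_eq_mul]
        refine mul_le_mul_of_nonneg_right ?_ (by positivity)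
        rw [Int.card_Icc]
        have : ((((n : ℤ) + 1 - (-(n : ℤ) - Q)).toNat : ℕ)) = 2 * n + Q + 1 := by omega
        rw [this]
        push_cast
        have : (1 : ℝ) ≤ n := by exact_mod_cast hn
        nlinarith [(Nat.cast_nonneg Q : (0 : ℝ) ≤ Q)]
    · intro l hl
      rw [h0 l (by rw [Finset.mem_Icc] at hl; omega)]
      simp
  rw [h1, norm_mul, norm_pow] at hup
  set Z := ‖∑' l : ℤ, (g l : ℂ) * w ^ l‖
  have hZ : 0 ≤ Z := norm_nonneg _
  have hpi := Real.pi_pos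
  have e1 : (2 / Real.pi * t) ^ Q * Z ≤ (Q + 3) * n * (B * (1 / (n : ℝ)) ^ Q) :=
    (mul_le_mul_of_nonneg_right (pow_le_pow_left₀ (by positivity) hlow Q) hZ).trans hup
  calc (n * t) ^ Q * Z = (Real.pi / 2) ^ Q * n ^ Q * ((2 / Real.pi * t) ^ Q * Z) := by
        rw [mul_pow, mul_pow, div_pow, div_pow]; field_simp
    _ ≤ (Real.pi / 2) ^ Q * n ^ Q * ((Q + 3) * n * (B * (1 / (n : ℝ)) ^ Q)) := by gcongr
    _ = _ := by rw [div_pow (1 : ℝ), one_pow]; field_simp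

variable {E : Type*} [MetricSpace E]

theorem localizedKernel_re_nonneg (hh : IsLowPassFilter h) (n : ℕ) (x y : E) :
    0 ≤ (localizedKernel h n x y).re := by
  rw [localizedKernel_eq_sq hh.even, Complex.ofReal_re]
  positivity

/-- All phases are at most `1`, so every cosine is at least `1 / 2` and nothing cancels. The
frequencies `|l| ≤ n / 2`, where the filter is `1`, number at least `n`, giving `n / 2` before
squaring. -/
theorem localizedKernel_re_ge (hh : IsLowPassFilter h) {n : ℕ} (hn : 1 ≤ n) {x y : E}
    (hxy : n * dist x y ≤ 1) : (n : ℝ) ^ 2 / 4 ≤ (localizedKernel h n x y).re := by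
  rw [localizedKernel_eq_sq hh.even, Complex.ofReal_re]
  have hn' : (0 : ℝ) < n := by exact_mod_cast hn
  have hcos : ∀ l ∈ Finset.Icc (-(n : ℤ)) (n : ℤ), 1 / 2 ≤ Real.cos ((l : ℝ) * dist x y) := by
    intro l hl
    have h1 : |(l : ℝ) * dist x y| ≤ 1 := by
      rw [abs_mul, abs_of_nonneg dist_nonneg]
      refine le_trans (mul_le_mul_of_nonneg_right ?_ dist_nonneg) hxy
      rw [Finset.mem_Icc] at hl
      exact_mod_cast abs_le.2 hl
    rw [← Real.cos_abs]
    have h2 : Real.cos 1 ≤ Real.cos |(l : ℝ) * dist x y| :=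
      Real.cos_le_cos_of_nonneg_of_le_pi (abs_nonneg _) (by linarith [Real.pi_gt_three]) h1
    exact le_trans (by linarith [Real.one_sub_sq_div_two_le_cos (x := 1)]) h2
  have hsum : (n : ℝ) / 2 ≤ ∑ l ∈ Finset.Icc (-(n : ℤ)) (n : ℤ),
      h ((l : ℝ) / (n : ℝ)) * Real.cos ((l : ℝ) * dist x y) := by
    have hsub : Finset.Icc (-((n / 2 : ℕ) : ℤ)) ((n / 2 : ℕ) : ℤ) ⊆
        Finset.Icc (-(n : ℤ)) (n : ℤ) := Finset.Icc_subset_Icc (by omega) (by omega)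
    refine le_trans ?_ (Finset.sum_le_sum_of_subset_of_nonneg hsub fun l hl _ =>
      mul_nonneg (hh.nonneg _) (le_trans (by norm_num) (hcos l hl)))
    refine le_trans ?_ (Finset.card_nsmul_le_sum _ _ (1 / 2) fun l hl => ?_)
    · rw [Int.card_Icc, nsmul_eq_mul]
      have : n ≤ ((((n / 2 : ℕ) : ℤ) + 1 - (-((n / 2 : ℕ) : ℤ))).toNat : ℕ) := by omega
      have : (n : ℝ) ≤ ((((n / 2 : ℕ) : ℤ) + 1 - (-((n / 2 : ℕ) : ℤ))).toNat : ℕ) := by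
        exact_mod_cast this
      linarith
    · rw [hh.eq_one, one_mul]
      · exact hcos l (hsub hl)
      · rw [Finset.mem_Icc] at hl
        have h2 : |2 * l| ≤ n := by rw [abs_le]; omega
        have h3 : |2 * (l : ℝ)| ≤ n := by exact_mod_cast h2
        rw [abs_div, Nat.abs_cast, div_le_div_iff₀ hn' two_pos]
        rw [abs_mul, abs_two] at h3
        linarith
  calc (n : ℝ) ^ 2 / 4 = ((n : ℝ) / 2) ^ 2 := by ring
    _ ≤ _ := by gcongr

/-- The kernel is at most of order `n ^ 2`, and decays at any polynomial rate in `n * dist x y`. -/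
theorem exists_localizedKernel_re_le (hh : IsLowPassFilter h) (S : ℝ) : ∃ D : ℝ, 0 < D ∧
    ∀ (E : Type*) [MetricSpace E] (n : ℕ), 1 ≤ n → ∀ x y : E, dist x y ≤ Real.pi →
      (localizedKernel h n x y).re ≤ D * n ^ 2 ∧ (1 ≤ n * dist x y →
        (localizedKernel h n x y).re ≤ D * n ^ 2 * (n * dist x y) ^ (-S)) := by
  -- For `n * dist ≥ 1` extra decay is harmless, so an integer exponent above `S` suffices.
  obtain ⟨Q, hQ⟩ := exists_nat_ge S
  obtain ⟨D₀, hD₀, h0⟩ := hh.exists_norm_sum_le 0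
  obtain ⟨D₁, hD₁, h1⟩ := hh.exists_norm_sum_le Q
  refine ⟨D₀ ^ 2 + D₁ ^ 2 + 1, by positivity, fun E _ n hn x y hxy => ?_⟩
  have hle : (localizedKernel h n x y).re ≤ ‖∑ l ∈ Finset.Icc (-(n : ℤ)) (n : ℤ),
      (h ((l : ℝ) / (n : ℝ)) : ℂ) *
        Complex.exp (Complex.I * ((l : ℝ) : ℂ) * (dist x y : ℂ))‖ ^ 2 := by
    rw [← norm_pow]; exact Complex.re_le_norm _
  have h0' := h0 n hn _ dist_nonneg hxy
  have h1' := h1 n hn _ dist_nonneg hxy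
  set Z := ‖∑ l ∈ Finset.Icc (-(n : ℤ)) (n : ℤ), (h ((l : ℝ) / (n : ℝ)) : ℂ) *
        Complex.exp (Complex.I * ((l : ℝ) : ℂ) * (dist x y : ℂ))‖
  have hZ : 0 ≤ Z := norm_nonneg _
  refine ⟨hle.trans ?_, fun hu => hle.trans ?_⟩
  · rw [pow_zero, one_mul] at h0'
    calc Z ^ 2 ≤ (D₀ * n) ^ 2 := by gcongr
      _ = D₀ ^ 2 * n ^ 2 := by ring
      _ ≤ _ := by gcongr; nlinarith [sq_nonneg D₁]
  · set u := n * dist x y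
    have hu0 : 0 < u := by linarith
    have hS : u ^ S ≤ (u ^ Q) ^ 2 := by
      calc u ^ S ≤ u ^ (Q : ℝ) := Real.rpow_le_rpow_of_exponent_le hu hQ
        _ = u ^ Q := Real.rpow_natCast u Q
        _ ≤ (u ^ Q) ^ 2 := le_self_pow₀ (one_le_pow₀ hu) two_ne_zero
    rw [Real.rpow_neg hu0.le, ← div_eq_mul_inv, le_div_iff₀ (by positivity)]
    calc Z ^ 2 * u ^ S ≤ Z ^ 2 * (u ^ Q) ^ 2 := by gcongr
      _ = (u ^ Q * Z) ^ 2 := by ring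
      _ ≤ (D₁ * n) ^ 2 := by gcongr
      _ = D₁ ^ 2 * n ^ 2 := by ring
      _ ≤ _ := by gcongr; nlinarith [sq_nonneg D₀]

end IsLowPassFilter

/-! ### Chernoff bounds for sample counts. -/

section Chernoff

open scoped Classical in
/-- The moment generating function of the number of independent samples that fall in a set. -/
theorem mgf_card_filter_mem_le {E Ω : Type*} [MeasurableSpace E] [MeasurableSpace Ω]
    {μ : Measure E} [IsProbabilityMeasure μ] {P : Measure Ω} [IsProbabilityMeasure P] {M : ℕ}
    {x : Fin M → Ω → E} (hx : ∀ j, Measurable (x j)) (hind : iIndepFun x P)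
    (hmap : ∀ j, P.map (x j) = μ) {s : Set E} (hs : MeasurableSet s) (t : ℝ) :
    Integrable (fun ω => Real.exp (t * (Finset.univ.filter fun j => x j ω ∈ s).card)) P ∧
    mgf (fun ω => ((Finset.univ.filter fun j => x j ω ∈ s).card : ℝ)) P t ≤
      Real.exp (M * (μ.real s * (Real.exp t - 1))) := by
  set g : E → ℝ := s.indicator 1 with hg
  have hgm : Measurable g := measurable_one.indicator hs
  have hfun : (fun ω => ((Finset.univ.filter fun j => x j ω ∈ s).card : ℝ)) =
      ∑ j, (g ∘ x j) := by
    ext ω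
    simp [hg, Set.indicator_apply]
  have hYm : ∀ j, Measurable (g ∘ x j) := fun j => hgm.comp (hx j)
  have hYi : iIndepFun (fun j => g ∘ x j) P := hind.comp (fun _ => g) (fun _ => hgm)
  have hone : ∀ j, mgf (g ∘ x j) P t = 1 + μ.real s * (Real.exp t - 1) := by
    intro j
    have e : ∀ z, Real.exp (t * g z) = 1 + s.indicator (fun _ => Real.exp t - 1) z := by
      intro z
      by_cases hz : z ∈ s <;> simp [hg, hz]
    rw [mgf, ← hmap j]
    calc ∫ ω, Real.exp (t * (g ∘ x j) ω) ∂P = ∫ z, Real.exp (t * g z) ∂(P.map (x j)) := by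
          rw [integral_map (hx j).aemeasurable]
          · rfl
          · exact (by fun_prop : Measurable fun z => Real.exp (t * g z)).aestronglyMeasurable
      _ = 1 + (P.map (x j)).real s * (Real.exp t - 1) := by
          have := Measure.isProbabilityMeasure_map (μ := P) (hx j).aemeasurable
          simp_rw [e]
          rw [integral_add (integrable_const _) ((integrable_const _).indicator hs),
            integral_indicator_const _ hs]
          simp
  constructor
  · refine Integrable.of_bound (C := Real.exp (|t| * M)) ?_ (Filter.Eventually.of_forall fun ω => ?_)
    · have hm : Measurable fun ω => ((Finset.univ.filter fun j => x j ω ∈ s).card : ℝ) := by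
        rw [hfun, Finset.sum_fn]; exact Finset.measurable_sum _ fun j _ => hYm j
      exact (by fun_prop : Measurable _).aestronglyMeasurable
    · rw [Real.norm_eq_abs, Real.abs_exp, Real.exp_le_exp]
      have h1 : ((Finset.univ.filter fun j => x j ω ∈ s).card : ℝ) ≤ M := by
        exact_mod_cast (Finset.card_le_univ _).trans (by simp)
      calc t * _ ≤ |t| * ((Finset.univ.filter fun j => x j ω ∈ s).card : ℝ) := by
            gcongr; exact le_abs_self t
        _ ≤ _ := by gcongr
  · rw [hfun, hYi.mgf_sum hYm, Real.exp_nat_mul]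
    refine (Finset.prod_le_prod (fun j _ => mgf_nonneg) (g := fun _ =>
      Real.exp (μ.real s * (Real.exp t - 1))) fun j _ => ?_).trans (by simp)
    rw [hone, add_comm]
    exact Real.add_one_le_exp _

open scoped Classical in
-- Exponential Markov inequality at `t = 1`: since `e - 1 ≤ 2`, the exponent is at most `2Mp - 3Mp`.
theorem measureReal_card_filter_mem_ge_le {E Ω : Type*} [MeasurableSpace E] [MeasurableSpace Ω]
    {μ : Measure E} [IsProbabilityMeasure μ] {P : Measure Ω} [IsProbabilityMeasure P] {M : ℕ}
    {x : Fin M → Ω → E} (hx : ∀ j, Measurable (x j)) (hind : iIndepFun x P)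
    (hmap : ∀ j, P.map (x j) = μ) {s : Set E} (hs : MeasurableSet s) {p : ℝ}
    (hp : μ.real s ≤ p) :
    P.real {ω | 3 * (M * p) ≤ ((Finset.univ.filter fun j => x j ω ∈ s).card : ℝ)} ≤
      Real.exp (-(M * p)) := by
  obtain ⟨h1, h2⟩ := mgf_card_filter_mem_le hx hind hmap hs 1
  refine (measure_ge_le_exp_mul_mgf _ zero_le_one h1).trans
    ((mul_le_mul_of_nonneg_left h2 (Real.exp_pos _).le).trans ?_)
  rw [← Real.exp_add, Real.exp_le_exp]
  have he : Real.exp 1 - 1 ≤ 2 := by linarith [Real.exp_one_lt_d9]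
  have hs0 : 0 ≤ μ.real s := measureReal_nonneg
  have h3 : (M : ℝ) * (μ.real s * (Real.exp 1 - 1)) ≤ M * (p * 2) :=
    mul_le_mul_of_nonneg_left (mul_le_mul hp he (by linarith [Real.exp_one_gt_d9])
      (hs0.trans hp)) (Nat.cast_nonneg M)
  linarith

open scoped Classical in
-- Exponential Markov inequality at `t = -1`: since `1 - e⁻¹ ≥ 1 / 2`, the exponent is at most `Mp /
-- 4 - Mp / 2`.
theorem measureReal_card_filter_mem_le_le {E Ω : Type*} [MeasurableSpace E] [MeasurableSpace Ω]
    {μ : Measure E} [IsProbabilityMeasure μ] {P : Measure Ω} [IsProbabilityMeasure P] {M : ℕ}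
    {x : Fin M → Ω → E} (hx : ∀ j, Measurable (x j)) (hind : iIndepFun x P)
    (hmap : ∀ j, P.map (x j) = μ) {s : Set E} (hs : MeasurableSet s) {p : ℝ}
    (hp : p ≤ μ.real s) :
    P.real {ω | ((Finset.univ.filter fun j => x j ω ∈ s).card : ℝ) ≤ M * p / 4} ≤
      Real.exp (-(M * p / 4)) := by
  obtain ⟨h1, h2⟩ := mgf_card_filter_mem_le hx hind hmap hs (-1)
  refine (measure_le_le_exp_mul_mgf _ (by norm_num) h1).trans
    ((mul_le_mul_of_nonneg_left h2 (Real.exp_pos _).le).trans ?_)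
  rw [← Real.exp_add, Real.exp_le_exp]
  have he : 1 / 2 ≤ 1 - Real.exp (-1) := by linarith [Real.exp_neg_one_lt_d9]
  have h3 : (M : ℝ) * (p * (1 / 2)) ≤ M * (μ.real s * (1 - Real.exp (-1))) := by gcongr
  linarith

end Chernoff

/-! ### Separated sets and nets. -/

section Packing

/-- Disjoint balls around separated points of a set where balls have large measure. -/
theorem card_mul_le_measureReal_of_separated {E : Type*} [MetricSpace E] [MeasurableSpace E]
    [BorelSpace E] {μ : Measure E} [IsFiniteMeasure μ] {ε q : ℝ} (t : Finset E)
    (hsep : ∀ y ∈ t, ∀ z ∈ t, y ≠ z → ε < dist y z)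
    (hq : ∀ y ∈ t, q ≤ μ.real (Metric.closedBall y (ε / 3)))
    {U : Set E} (hU : ∀ y ∈ t, Metric.closedBall y (ε / 3) ⊆ U) :
    t.card * q ≤ μ.real U := by
  rcases lt_or_ge ε 0 with hε | hε
  · have : ∀ y ∈ t, q ≤ 0 := fun y hy => by
      have h1 := hq y hy
      rwa [Metric.closedBall_eq_empty.2 (by linarith), measureReal_empty] at h1
    rcases t.eq_empty_or_nonempty with rfl | ⟨y, hy⟩
    · simp
    · exact (mul_nonpos_of_nonneg_of_nonpos (by positivity) (this y hy)).trans measureReal_nonneg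
  calc t.card * q = ∑ y ∈ t, q := by simp
    _ ≤ ∑ y ∈ t, μ.real (Metric.closedBall y (ε / 3)) := Finset.sum_le_sum hq
    _ = μ.real (⋃ y ∈ t, Metric.closedBall y (ε / 3)) := by
        rw [measureReal_biUnion_finset]
        · intro y hy z hz hyz
          exact Metric.closedBall_disjoint_closedBall (by linarith [hsep y hy z hz hyz])
        · exact fun _ _ => Metric.isClosed_closedBall.measurableSet
    _ ≤ μ.real U := measureReal_mono (Set.iUnion₂_subset hU)

/-- A set whose separated finite subsets have bounded cardinality has a finite separated net. -/
theorem exists_separated_net {E : Type*} [MetricSpace E] {ε : ℝ} (hε : 0 ≤ ε) (X : Set E) (N : ℕ)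
    (hN : ∀ t : Finset E, ↑t ⊆ X → (∀ y ∈ t, ∀ z ∈ t, y ≠ z → ε < dist y z) → t.card ≤ N) :
    ∃ t : Finset E, ↑t ⊆ X ∧ (∀ y ∈ t, ∀ z ∈ t, y ≠ z → ε < dist y z) ∧
      ∀ z ∈ X, ∃ y ∈ t, dist z y ≤ ε := by
  classical
  -- Choose a separated subset of largest cardinality; a point it fails to cover could be added to
  -- it.
  obtain ⟨k, ⟨t, htX, hsep, rfl⟩, hmax⟩ : ∃ k, (∃ t : Finset E, ↑t ⊆ X ∧
      (∀ y ∈ t, ∀ z ∈ t, y ≠ z → ε < dist y z) ∧ t.card = k) ∧ ∀ m, k < m → m ≤ N →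
        ¬ ∃ t : Finset E, ↑t ⊆ X ∧ (∀ y ∈ t, ∀ z ∈ t, y ≠ z → ε < dist y z) ∧ t.card = m :=
    ⟨_, Nat.findGreatest_spec (P := fun k => ∃ t : Finset E, ↑t ⊆ X ∧
      (∀ y ∈ t, ∀ z ∈ t, y ≠ z → ε < dist y z) ∧ t.card = k) (Nat.zero_le N) ⟨∅, by simp⟩,
      fun m hm hmN => Nat.findGreatest_is_greatest hm hmN⟩
  refine ⟨t, htX, hsep, fun z hz => ?_⟩
  by_contra! hc
  have hzt : z ∉ t := fun h => by linarith [hc z h, dist_self z]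
  have h1 : ((insert z t : Finset E) : Set E) ⊆ X := by
    rw [Finset.coe_insert]; exact Set.insert_subset hz htX
  have h2 : ∀ y ∈ insert z t, ∀ w ∈ insert z t, y ≠ w → ε < dist y w := by
    intro y hy w hw hyw
    rcases Finset.mem_insert.1 hy with rfl | hy' <;> rcases Finset.mem_insert.1 hw with rfl | hw'
    · exact absurd rfl hyw
    · exact hc w hw'
    · rw [dist_comm]; exact hc y hy'
    · exact hsep y hy' w hw' hyw
  exact hmax _ (by rw [Finset.card_insert_of_notMem hzt]; omega) (hN _ h1 h2) ⟨_, h1, h2, rfl⟩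

end Packing

/-! ### Summing the decay over dyadic shells. -/

section LayerSum

/-- If a finite family of reals `u j ≥ R ≥ 1` has at most `B * t ^ α` members below each `t`, then
`∑ u j ^ (-S)` is at most of order `R ^ (-(S - α))`. -/
theorem sum_rpow_neg_le_of_card_le {ι : Type*} (s : Finset ι) (u : ι → ℝ) {α S B R : ℝ}
    (hα : 0 ≤ α) (hS : α < S) (hB : 0 ≤ B) (hR : 1 ≤ R) (hu : ∀ j ∈ s, R ≤ u j)
    (hcard : ∀ t : ℝ, 1 ≤ t → ((s.filter fun j => u j ≤ t).card : ℝ) ≤ B * t ^ α) :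
    ∑ j ∈ s, u j ^ (-S) ≤ B * (1 + 2 ^ α / (1 - 2 ^ (-(S - α)))) * R ^ (-(S - α)) := by
  classical
  have hR0 : 0 < R := by linarith
  set q : ℝ := 2 ^ (-(S - α)) with hq
  have hq0 : 0 < q := by positivity
  have hq1 : q < 1 := Real.rpow_lt_one_of_one_lt_of_neg one_lt_two (by linarith)
  -- The shell between `2 ^ K * R` and twice that has at most `B * (2 ^ (K + 1) * R) ^ α` members,
  -- each contributing at most `(2 ^ K * R) ^ (-S)`: a geometric series of ratio `q < 1`, as `S >
  -- α`.
  have step : ∀ K : ℕ, ∑ j ∈ s.filter (fun j => u j ≤ 2 ^ K * R), u j ^ (-S) ≤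
      B * R ^ (-(S - α)) + ∑ k ∈ Finset.range K, B * 2 ^ α * R ^ (-(S - α)) * q ^ k := by
    intro K
    induction K with
    | zero =>
      simp only [pow_zero, one_mul, Finset.range_zero, Finset.sum_empty, add_zero]
      calc ∑ j ∈ s.filter (fun j => u j ≤ R), u j ^ (-S)
          ≤ ∑ j ∈ s.filter (fun j => u j ≤ R), R ^ (-S) := Finset.sum_le_sum fun j hj =>
            Real.rpow_le_rpow_of_nonpos hR0 (hu j (Finset.mem_filter.1 hj).1) (by linarith)
        _ = ((s.filter fun j => u j ≤ R).card : ℝ) * R ^ (-S) := by simp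
        _ ≤ B * R ^ α * R ^ (-S) := by gcongr; exact hcard R hR
        _ = _ := by rw [mul_assoc, ← Real.rpow_add hR0]; congr 2; ring
    | succ K ih =>
      rw [Finset.sum_range_succ, ← add_assoc]
      set v : ℝ := 2 ^ K * R with hv
      have hv1 : 1 ≤ v := one_le_mul_of_one_le_of_one_le (one_le_pow₀ one_le_two) hR
      have hv0 : 0 < v := by linarith
      have hv2 : 2 ^ (K + 1) * R = 2 * v := by rw [hv, pow_succ]; ring
      rw [hv2]
      have hsub : s.filter (fun j => u j ≤ v) ⊆ s.filter (fun j => u j ≤ 2 * v) := fun j hj => by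
        rw [Finset.mem_filter] at hj ⊢
        exact ⟨hj.1, by linarith [hj.2]⟩
      rw [← Finset.sum_sdiff hsub, add_comm]
      refine add_le_add ih ?_
      set T := s.filter (fun j => u j ≤ 2 * v) \ s.filter (fun j => u j ≤ v) with hT
      have hTle : (T.card : ℝ) ≤ B * (2 * v) ^ α :=
        le_trans (by exact_mod_cast Finset.card_le_card Finset.sdiff_subset)
          (hcard (2 * v) (by linarith))
      calc ∑ j ∈ T, u j ^ (-S) ≤ ∑ j ∈ T, v ^ (-S) := Finset.sum_le_sum fun j hj => by
            simp only [hT, Finset.mem_sdiff, Finset.mem_filter, not_and, not_le] at hj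
            exact Real.rpow_le_rpow_of_nonpos hv0 (hj.2 hj.1.1).le (by linarith)
        _ = (T.card : ℝ) * v ^ (-S) := by simp
        _ ≤ B * (2 * v) ^ α * v ^ (-S) := by gcongr
        _ = B * 2 ^ α * v ^ (-(S - α)) := by
            rw [Real.mul_rpow zero_le_two hv0.le, show -(S - α) = α + -S by ring,
              Real.rpow_add hv0]
            ring
        _ = B * 2 ^ α * R ^ (-(S - α)) * q ^ K := by
            rw [hv, Real.mul_rpow (by positivity) hR0.le, hq, Real.rpow_pow_comm zero_le_two]
            ring
  have hexists : ∃ K : ℕ, ∀ j ∈ s, u j ≤ 2 ^ K * R := by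
    obtain ⟨c, hc⟩ := (s.finite_toSet.image u).bddAbove
    obtain ⟨K, hK⟩ := pow_unbounded_of_one_lt c one_lt_two
    refine ⟨K, fun j hj => (hc ⟨j, hj, rfl⟩).trans (hK.le.trans ?_)⟩
    exact le_mul_of_one_le_right (by positivity) hR
  obtain ⟨K, hK⟩ := hexists
  have hfin := step K
  rw [Finset.filter_true_of_mem hK, ← Finset.mul_sum] at hfin
  refine hfin.trans ?_
  have hgeo : ∑ k ∈ Finset.range K, q ^ k ≤ (1 - q)⁻¹ := by
    rw [← tsum_geometric_of_lt_one hq0.le hq1]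
    exact (summable_geometric_of_lt_one hq0.le hq1).sum_le_tsum _ fun k _ => by positivity
  calc _ ≤ B * R ^ (-(S - α)) + B * 2 ^ α * R ^ (-(S - α)) * (1 - q)⁻¹ := by gcongr
    _ = _ := by rw [div_eq_mul_inv]; ring

end LayerSum

/-! ### Deterministic bounds on the estimator from sample counts. -/

section Estimator

variable {h : ℝ → ℝ} {E : Type*} [MetricSpace E] {n M : ℕ} {x : Fin M → E} {z : E}
  {α S D β : ℝ}

theorem supportEstimator_le_of_far (hM : 1 ≤ M) (hα : 0 ≤ α) (hS : α < S) (hD : 0 ≤ D)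
    (hβ : 0 ≤ β)
    (hker : ∀ j, 1 ≤ n * dist z (x j) →
      (localizedKernel h n z (x j)).re ≤ D * n ^ 2 * (n * dist z (x j)) ^ (-S))
    (hcount : ∀ t : ℝ, 1 ≤ t →
      ((Finset.univ.filter fun j => n * dist z (x j) ≤ t).card : ℝ) ≤ β * M * t ^ α)
    {R : ℝ} (hR : 1 ≤ R) (hfar : ∀ j, R ≤ n * dist z (x j)) :
    supportEstimator h n x z ≤
      D * n ^ 2 * β * (1 + 2 ^ α / (1 - 2 ^ (-(S - α)))) * R ^ (-(S - α)) := by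
  have hM' : (0 : ℝ) < M := by exact_mod_cast hM
  have hsum := sum_rpow_neg_le_of_card_le Finset.univ (fun j => n * dist z (x j)) hα hS
    (by positivity : 0 ≤ β * M) hR (fun j _ => hfar j) hcount
  rw [supportEstimator, one_div, inv_mul_le_iff₀ hM']
  calc ∑ j, (localizedKernel h n z (x j)).re
      ≤ ∑ j, D * n ^ 2 * (n * dist z (x j)) ^ (-S) :=
        Finset.sum_le_sum fun j _ => hker j (hR.trans (hfar j))
    _ = D * n ^ 2 * ∑ j, (n * dist z (x j)) ^ (-S) := by rw [Finset.mul_sum]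
    _ ≤ D * n ^ 2 * (β * M * (1 + 2 ^ α / (1 - 2 ^ (-(S - α)))) * R ^ (-(S - α))) :=
        mul_le_mul_of_nonneg_left hsum (by positivity)
    _ = _ := by ring

/-- Samples within scaled distance `1` are charged the full height `D * n ^ 2`, which turns the `1`
of the far bound into `2`; the others are the layer sum with `R = 1`. -/
theorem supportEstimator_le (hM : 1 ≤ M) (hα : 0 ≤ α) (hS : α < S) (hD : 0 ≤ D)
    (hβ : 0 ≤ β)
    (hker : ∀ j, (localizedKernel h n z (x j)).re ≤ D * n ^ 2 ∧ (1 ≤ n * dist z (x j) →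
      (localizedKernel h n z (x j)).re ≤ D * n ^ 2 * (n * dist z (x j)) ^ (-S)))
    (hcount : ∀ t : ℝ, 1 ≤ t →
      ((Finset.univ.filter fun j => n * dist z (x j) ≤ t).card : ℝ) ≤ β * M * t ^ α) :
    supportEstimator h n x z ≤ D * n ^ 2 * β * (2 + 2 ^ α / (1 - 2 ^ (-(S - α)))) := by
  classical
  have hM' : (0 : ℝ) < M := by exact_mod_cast hM
  set near := Finset.univ.filter fun j => n * dist z (x j) ≤ 1
  set far := Finset.univ.filter fun j => ¬ n * dist z (x j) ≤ 1
  have hmem : ∀ j ∈ far, 1 ≤ n * dist z (x j) := fun j hj =>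
    (not_le.1 (Finset.mem_filter.1 hj).2).le
  have hsum := sum_rpow_neg_le_of_card_le far (fun j => n * dist z (x j)) hα hS
    (by positivity : 0 ≤ β * M) le_rfl hmem (fun t ht => le_trans (by
      exact_mod_cast Finset.card_le_card (Finset.filter_subset_filter _ (Finset.subset_univ _)))
      (hcount t ht))
  rw [Real.one_rpow, mul_one] at hsum
  have hnear := hcount 1 le_rfl
  rw [Real.one_rpow, mul_one] at hnear
  rw [supportEstimator, one_div, inv_mul_le_iff₀ hM',
    ← Finset.sum_filter_add_sum_filter_not _ (fun j => n * dist z (x j) ≤ 1)]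
  calc _ ≤ ∑ j ∈ near, D * n ^ 2 + ∑ j ∈ far, D * n ^ 2 * (n * dist z (x j)) ^ (-S) :=
        add_le_add (Finset.sum_le_sum fun j _ => (hker j).1)
          (Finset.sum_le_sum fun j hj => (hker j).2 (hmem j hj))
    _ = D * n ^ 2 * (near.card + ∑ j ∈ far, (n * dist z (x j)) ^ (-S)) := by
        rw [Finset.sum_const, nsmul_eq_mul, ← Finset.mul_sum]; ring
    _ ≤ D * n ^ 2 * (β * M + β * M * (1 + 2 ^ α / (1 - 2 ^ (-(S - α))))) :=
        mul_le_mul_of_nonneg_left (add_le_add hnear hsum) (by positivity)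
    _ = _ := by ring

theorem IsLowPassFilter.le_supportEstimator (hh : IsLowPassFilter h) (hn : 1 ≤ n) (hM : 1 ≤ M)
    {γ : ℝ} (hcount : γ * M ≤ ((Finset.univ.filter fun j => n * dist z (x j) ≤ 1).card : ℝ)) :
    n ^ 2 * γ / 4 ≤ supportEstimator h n x z := by
  have hM' : (0 : ℝ) < M := by exact_mod_cast hM
  rw [supportEstimator, one_div, ← div_eq_inv_mul, le_div_iff₀ hM']
  calc n ^ 2 * γ / 4 * M = γ * M * ((n : ℝ) ^ 2 / 4) := by ring
    _ ≤ ((Finset.univ.filter fun j => n * dist z (x j) ≤ 1).card : ℝ) * ((n : ℝ) ^ 2 / 4) := by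
        gcongr
    _ = ∑ j ∈ Finset.univ.filter (fun j => n * dist z (x j) ≤ 1), (n : ℝ) ^ 2 / 4 := by simp
    _ ≤ ∑ j ∈ Finset.univ.filter (fun j => n * dist z (x j) ≤ 1),
          (localizedKernel h n z (x j)).re := Finset.sum_le_sum fun j hj =>
        hh.localizedKernel_re_ge hn (Finset.mem_filter.1 hj).2
    _ ≤ _ := Finset.sum_le_sum_of_subset_of_nonneg (Finset.filter_subset _ _) fun j _ _ =>
        hh.localizedKernel_re_nonneg _ _ _

/-- Two-sided inclusions for the support estimator set, given counts of sample points in balls. -/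
theorem IsLowPassFilter.supportEstimatorSet_inclusions (hh : IsLowPassFilter h)
    (hn : 1 ≤ n) (hM : 1 ≤ M) (hα : 0 ≤ α) (hS : α < S) (hD : 0 ≤ D) (hβ : 0 ≤ β) {X : Set E}
    (hxX : ∀ j, x j ∈ X)
    (hker : ∀ y z : E, (localizedKernel h n y z).re ≤ D * n ^ 2 ∧ (1 ≤ n * dist y z →
      (localizedKernel h n y z).re ≤ D * n ^ 2 * (n * dist y z) ^ (-S)))
    (hupper : ∀ z : E, ∀ t : ℝ, 1 ≤ t →
      ((Finset.univ.filter fun j => n * dist z (x j) ≤ t).card : ℝ) ≤ β * M * t ^ α)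
    {γ : ℝ} (hlower : ∀ z ∈ X,
      γ * M ≤ ((Finset.univ.filter fun j => n * dist z (x j) ≤ 1).card : ℝ))
    {Θ R : ℝ} (hΘ : 0 < Θ) (hR : 1 ≤ R)
    (hΘ1 : Θ * (D * β * (2 + 2 ^ α / (1 - 2 ^ (-(S - α))))) ≤ γ / 4)
    (hΘ2 : D * β * (1 + 2 ^ α / (1 - 2 ^ (-(S - α)))) * R ^ (-(S - α)) < Θ * (γ / 4)) :
    X ⊆ supportEstimatorSet h n x Θ ∧
      supportEstimatorSet h n x Θ ⊆ Metric.cthickening (R / n) X := by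
  have hn' : (0 : ℝ) < n := by exact_mod_cast hn
  have : Nonempty (Fin M) := ⟨⟨0, hM⟩⟩
  constructor
  · intro z hz
    have h1 : (⨆ k : Fin M, supportEstimator h n x (x k)) ≤
        D * n ^ 2 * β * (2 + 2 ^ α / (1 - 2 ^ (-(S - α)))) :=
      ciSup_le fun k => supportEstimator_le hM hα hS hD hβ (fun j => hker _ _) (hupper _)
    refine le_trans ?_ (hh.le_supportEstimator hn hM (hlower z hz))
    calc _ ≤ Θ * (D * n ^ 2 * β * (2 + 2 ^ α / (1 - 2 ^ (-(S - α))))) := by gcongr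
      _ = n ^ 2 * (Θ * (D * β * (2 + 2 ^ α / (1 - 2 ^ (-(S - α)))))) := by ring
      _ ≤ n ^ 2 * (γ / 4) := by gcongr
      _ = _ := by ring
  · intro z hz
    by_contra hzc
    rw [Metric.mem_cthickening_iff, not_le] at hzc
    have hfar : ∀ j, R ≤ n * dist z (x j) := by
      intro j
      have h1 := hzc.le.trans (Metric.infEDist_le_edist_of_mem (hxX j))
      rw [edist_dist, ENNReal.ofReal_le_ofReal_iff dist_nonneg, div_le_iff₀ hn'] at h1
      linarith
    have h1 := supportEstimator_le_of_far hM hα hS hD hβ (fun j => (hker z (x j)).2) (hupper z)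
      hR hfar
    -- Any sample will do: it lies in `X`, so the lower bound there bounds the maximum from below.
    let k : Fin M := ⟨0, hM⟩
    have h2 := hh.le_supportEstimator hn hM (hlower (x k) (hxX k))
    have h3 : supportEstimator h n x (x k) ≤ ⨆ k : Fin M, supportEstimator h n x (x k) :=
      le_ciSup (f := fun k => supportEstimator h n x (x k)) (Set.finite_range _).bddAbove k
    have hz' : Θ * (⨆ k : Fin M, supportEstimator h n x (x k)) ≤ supportEstimator h n x z := hz
    have h4 : Θ * (n ^ 2 * γ / 4) ≤ Θ * (⨆ k : Fin M, supportEstimator h n x (x k)) := by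
      gcongr; exact h2.trans h3
    have h5 := mul_lt_mul_of_pos_left hΘ2 (by positivity : (0 : ℝ) < n ^ 2)
    linarith

end Estimator

/-! ### Uniform sample counts with high probability. -/

section Counting

variable {E : Type*} [MetricSpace E] [MeasurableSpace E] [BorelSpace E] {μ : Measure E}
  [IsProbabilityMeasure μ] {α κ κ₂ r₀ ε : ℝ} {X : Set E} {M : ℕ}

/-- Control of the counts in the balls of a net yields control of the counts in all balls. -/
theorem card_filter_dist_le_of_net (hκ₂ : 0 < κ₂) (hε : 0 < ε)
    (hεr : ε ≤ r₀)
    (hupper : ∀ z : E, ∀ r : ℝ, 0 < r → μ.real (Metric.closedBall z r) ≤ κ * r ^ α)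
    (hlower : ∀ z ∈ X, ∀ r : ℝ, 0 < r → r ≤ r₀ → κ₂ * r ^ α ≤ μ.real (Metric.closedBall z r))
    {t : Finset E} (htX : ↑t ⊆ X) (hsep : ∀ y ∈ t, ∀ z ∈ t, y ≠ z → ε < dist y z)
    (hcover : ∀ z ∈ X, ∃ y ∈ t, dist z y ≤ ε) {x : Fin M → E} (hx : ∀ j, x j ∈ X)
    {b : ℝ} (hb : 0 ≤ b)
    (hcount : ∀ y ∈ t, ((Finset.univ.filter fun j => dist (x j) y ≤ ε).card : ℝ) ≤ b)
    (z : E) {r : ℝ} (hr : ε ≤ r) :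
    ((Finset.univ.filter fun j => dist z (x j) ≤ r).card : ℝ) ≤
      κ / κ₂ * (9 * r / ε) ^ α * b := by
  classical
  -- Only these net points can cover a sample in the ball. Their `ε / 3`-balls are disjoint and lie
  -- in radius `3 * r`, as `r ≥ ε`; the `9` is `3 * r` over `ε / 3`.
  set T := t.filter fun y => dist z y ≤ r + ε
  have hT : (T.card : ℝ) * (κ₂ * (ε / 3) ^ α) ≤ κ * (3 * r) ^ α := by
    refine (card_mul_le_measureReal_of_separated (ε := ε) (U := Metric.closedBall z (3 * r)) T
      (fun y hy w hw => hsep y (Finset.mem_filter.1 hy).1 w (Finset.mem_filter.1 hw).1)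
      (fun y hy => hlower y (htX (Finset.mem_filter.1 hy).1) _ (by positivity) (by linarith))
      fun y hy => ?_).trans (hupper z _ (by linarith))
    apply Metric.closedBall_subset_closedBall'
    have := (Finset.mem_filter.1 hy).2
    rw [dist_comm] at this
    linarith
  have hT' : (T.card : ℝ) ≤ κ / κ₂ * (9 * r / ε) ^ α := by
    have e : 9 * r / ε = 3 * r / (ε / 3) := by field_simp; ring
    rw [e, Real.div_rpow (by linarith) (by positivity), div_mul_div_comm, le_div_iff₀ (by positivity)]
    exact hT
  have hsub : (Finset.univ.filter fun j => dist z (x j) ≤ r) ⊆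
      T.biUnion fun y => Finset.univ.filter fun j => dist (x j) y ≤ ε := by
    intro j hj
    obtain ⟨y, hy, hjy⟩ := hcover (x j) (hx j)
    rw [Finset.mem_biUnion]
    refine ⟨y, Finset.mem_filter.2 ⟨hy, ?_⟩, by simpa using hjy⟩
    linarith [dist_triangle z (x j) y, (Finset.mem_filter.1 hj).2]
  calc ((Finset.univ.filter fun j => dist z (x j) ≤ r).card : ℝ)
      ≤ ∑ y ∈ T, ((Finset.univ.filter fun j => dist (x j) y ≤ ε).card : ℝ) := by
        exact_mod_cast (Finset.card_le_card hsub).trans Finset.card_biUnion_le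
    _ ≤ ∑ y ∈ T, b := Finset.sum_le_sum fun y hy => hcount y (Finset.mem_filter.1 hy).1
    _ = T.card * b := by simp
    _ ≤ _ := by gcongr

/-- With high probability every ball contains about the expected number of sample points. -/
theorem measureReal_compl_counts_le [SecondCountableTopology E]
    (hκ : 0 ≤ κ) (hκ₂ : 0 < κ₂) (hε : 0 < ε) (hεr : ε ≤ r₀)
    (hupper : ∀ z : E, ∀ r : ℝ, 0 < r → μ.real (Metric.closedBall z r) ≤ κ * r ^ α)
    (hlower : ∀ z ∈ μ.support, ∀ r : ℝ, 0 < r → r ≤ r₀ →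
      κ₂ * r ^ α ≤ μ.real (Metric.closedBall z r))
    {Ω : Type*} [MeasurableSpace Ω] {P : Measure Ω} [IsProbabilityMeasure P]
    {x : Fin M → Ω → E} (hx : ∀ j, Measurable (x j)) (hind : iIndepFun x P)
    (hmap : ∀ j, P.map (x j) = μ) :
    P.real {ω | (∀ j, x j ω ∈ μ.support) ∧
      (∀ z : E, ∀ r : ℝ, ε ≤ r → ((Finset.univ.filter fun j => dist z (x j ω) ≤ r).card : ℝ) ≤
        κ / κ₂ * (9 * r / ε) ^ α * (3 * (M * (κ * ε ^ α)))) ∧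
      ∀ z ∈ μ.support, M * (κ₂ * ε ^ α) / 4 ≤
        ((Finset.univ.filter fun j => dist z (x j ω) ≤ 2 * ε).card : ℝ)}ᶜ ≤
      2 / (κ₂ * (ε / 3) ^ α) * Real.exp (-(M * (κ₂ * ε ^ α) / 4)) := by
  classical
  have hcard : ∀ t : Finset E, ↑t ⊆ μ.support → (∀ y ∈ t, ∀ z ∈ t, y ≠ z → ε < dist y z) →
      (t.card : ℝ) ≤ 1 / (κ₂ * (ε / 3) ^ α) := by
    intro t htX hsep
    rw [le_div_iff₀ (by positivity)]
    exact (card_mul_le_measureReal_of_separated (ε := ε) (U := Set.univ) (μ := μ) t hsep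
      (fun y hy => hlower y (htX hy) _ (by positivity) (by linarith))
      fun _ _ => Set.subset_univ _).trans (by simp)
  obtain ⟨t, htX, hsep, hcover⟩ := exists_separated_net hε.le μ.support
    ⌊1 / (κ₂ * (ε / 3) ^ α)⌋₊ fun t h1 h2 => Nat.le_floor (hcard t h1 h2)
  set cnt : E → Ω → ℝ := fun y ω =>
    ((Finset.univ.filter fun j => x j ω ∈ Metric.closedBall y ε).card : ℝ)
  set bad : E → Set Ω := fun y =>
    {ω | 3 * (M * (κ * ε ^ α)) ≤ cnt y ω} ∪ {ω | cnt y ω ≤ M * (κ₂ * ε ^ α) / 4}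
  set null : Set Ω := ⋃ j, x j ⁻¹' μ.supportᶜ
  have hnull : P.real null = 0 := by
    have : P null = 0 := by
      refine measure_iUnion_null fun j => ?_
      rw [← Measure.map_apply (hx j) Measure.isOpen_compl_support.measurableSet, hmap]
      exact Measure.measure_compl_support
    simp [Measure.real, this]
  have hbad : ∀ y ∈ t, P.real (bad y) ≤ 2 * Real.exp (-(M * (κ₂ * ε ^ α) / 4)) := by
    intro y hy
    have hs : MeasurableSet (Metric.closedBall y ε) := Metric.isClosed_closedBall.measurableSet
    have hu := hupper y ε hε
    have hl := hlower y (htX hy) ε hε hεr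
    have h1 := measureReal_card_filter_mem_ge_le hx hind hmap hs hu
    have h2 := measureReal_card_filter_mem_le_le hx hind hmap hs hl
    refine (measureReal_union_le _ _).trans ?_
    -- The upper tail is the smaller one, because `κ₂ * ε ^ α ≤ κ * ε ^ α` by comparing both with
    -- the measure of the ball.
    have h3 : Real.exp (-(M * (κ * ε ^ α))) ≤ Real.exp (-(M * (κ₂ * ε ^ α) / 4)) := by
      rw [Real.exp_le_exp]
      have : (M : ℝ) * (κ₂ * ε ^ α) ≤ M * (κ * ε ^ α) :=
        mul_le_mul_of_nonneg_left (hl.trans hu) (Nat.cast_nonneg M)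
      have : (0 : ℝ) ≤ M * (κ₂ * ε ^ α) := by positivity
      linarith
    linarith
  have hsub : {ω | (∀ j, x j ω ∈ μ.support) ∧
      (∀ z : E, ∀ r : ℝ, ε ≤ r → ((Finset.univ.filter fun j => dist z (x j ω) ≤ r).card : ℝ) ≤
        κ / κ₂ * (9 * r / ε) ^ α * (3 * (M * (κ * ε ^ α)))) ∧
      ∀ z ∈ μ.support, M * (κ₂ * ε ^ α) / 4 ≤
        ((Finset.univ.filter fun j => dist z (x j ω) ≤ 2 * ε).card : ℝ)}ᶜ ⊆
      null ∪ ⋃ y ∈ t, bad y := by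
    rw [Set.compl_subset_comm]
    intro ω hω
    simp only [null, bad, Set.mem_compl_iff, Set.mem_union, Set.mem_iUnion, Set.mem_preimage,
      Set.mem_ofPred_eq, not_or, not_exists, not_not, not_le] at hω
    obtain ⟨h1, h2⟩ := hω
    refine ⟨h1, fun z r hr => ?_, fun z hz => ?_⟩
    · exact card_filter_dist_le_of_net hκ₂ hε hεr hupper hlower htX hsep hcover h1
        (by positivity) (fun y hy => (h2 y hy).1.le) z hr
    -- The ball of radius `2 * ε` at `z` contains the `ε`-ball of a nearby net point; hence the
    -- doubled radius.
    · obtain ⟨y, hy, hzy⟩ := hcover z hz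
      refine (h2 y hy).2.le.trans ?_
      refine Nat.cast_le.2 (Finset.card_le_card fun j hj => ?_)
      simp only [Finset.mem_filter, Finset.mem_univ, true_and, Metric.mem_closedBall] at hj ⊢
      linarith [dist_triangle z y (x j ω), dist_comm y (x j ω)]
  calc _ ≤ P.real (null ∪ ⋃ y ∈ t, bad y) := measureReal_mono hsub
    _ ≤ P.real null + ∑ y ∈ t, P.real (bad y) := (measureReal_union_le _ _).trans
        (by gcongr; exact measureReal_biUnion_finset_le _ _)
    _ ≤ 0 + ∑ y ∈ t, 2 * Real.exp (-(M * (κ₂ * ε ^ α) / 4)) := by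
        rw [hnull]; gcongr with y hy; exact hbad y hy
    _ = t.card * (2 * Real.exp (-(M * (κ₂ * ε ^ α) / 4))) := by simp
    _ ≤ 1 / (κ₂ * (ε / 3) ^ α) * (2 * Real.exp (-(M * (κ₂ * ε ^ α) / 4))) := by
        gcongr; exact hcard t htX hsep
    _ = _ := by ring

end Counting

/-! ### Choice of constants and conclusion. -/

/-- With `t = M * n ^ (-α)` the left side is `t * n ^ (2α) * exp (-b t)`. The lower bound on `M`
gives `n ^ (2α) ≤ exp (b t / 2)`, and `t * exp (-b t / 2) ≤ 2 / b`. -/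
theorem rpow_mul_mul_exp_le {α b : ℝ} (hb : 0 < b) {n M : ℕ} (hn : 1 ≤ n)
    (hM : (4 * α / b + 1) * (n : ℝ) ^ α * Real.log n ≤ M) :
    (n : ℝ) ^ α * M * Real.exp (-(b * (M * (n : ℝ) ^ (-α)))) ≤ 2 / b := by
  have hn0 : (0 : ℝ) < n := by exact_mod_cast hn
  have hL : 0 ≤ Real.log n := Real.log_natCast_nonneg n
  have hnα : (n : ℝ) ^ α = Real.exp (Real.log n * α) := Real.rpow_def_of_pos hn0 α
  have hpos : 0 < (n : ℝ) ^ α := by positivity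
  set L := Real.log n
  set t : ℝ := M * (n : ℝ) ^ (-α) with ht
  have hMt : (M : ℝ) = t * (n : ℝ) ^ α := by
    rw [ht, mul_assoc, ← Real.rpow_add hn0, neg_add_cancel, Real.rpow_zero, mul_one]
  have ht0 : 0 ≤ t := by positivity
  have hLt : (4 * α / b + 1) * L ≤ t := by
    rw [hMt] at hM
    exact le_of_mul_le_mul_right (by linarith) hpos
  have h4 : 4 * α * L ≤ b * t := by
    calc 4 * α * L = b * (4 * α / b * L) := by field_simp
      _ ≤ b * t := by gcongr; linarith
  calc (n : ℝ) ^ α * M * Real.exp (-(b * t))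
      = t * Real.exp (2 * α * L - b * t) := by
        rw [hMt, hnα, show 2 * α * L - b * t = L * α + L * α + -(b * t) by ring, Real.exp_add,
          Real.exp_add]
        ring
    _ ≤ t * Real.exp (-(b * t / 2)) := by gcongr; linarith
    _ ≤ 2 / b := by
        rw [Real.exp_neg, ← div_eq_mul_inv, div_le_div_iff₀ (Real.exp_pos _) hb]
        linarith [Real.add_one_le_exp (b * t / 2)]

/-- Removes the restriction `r ≤ π`: larger balls are the whole space. The `+ 1` makes the constant
positive before any measure is given. -/
theorem IsDetectable.measureReal_closedBall_le {E : Type*} [MetricSpace E] [CompactSpace E]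
    [MeasurableSpace E] [BorelSpace E] {μ : Measure E} [IsProbabilityMeasure μ]
    {α κ₁ κ₂ r₀ : ℝ} (hμ : IsDetectable μ α κ₁ κ₂ r₀)
    (hdist : ∀ y z : E, dist y z ≤ Real.pi) (z : E) {r : ℝ} (hr : 0 < r) :
    μ.real (Metric.closedBall z r) ≤ (κ₁ + 1) * r ^ α := by
  have h0 := hμ.upper_const_nonneg
  have hα := hμ.exponent_nonneg
  have key : ∀ s : ℝ, 0 < s → s ≤ Real.pi → μ.real (Metric.closedBall z s) ≤ κ₁ * s ^ α :=
    fun s hs hs' => ENNReal.toReal_le_of_le_ofReal (by positivity)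
      (hμ.measure_closedBall_le z s hs hs')
  have hle : κ₁ * r ^ α ≤ (κ₁ + 1) * r ^ α := by gcongr; linarith
  rcases le_total r Real.pi with h | h
  · exact (key r hr h).trans hle
  · have h1 : Metric.closedBall z Real.pi = Set.univ :=
      Set.eq_univ_of_forall fun y => hdist y z
    have h2 := key Real.pi Real.pi_pos le_rfl
    rw [h1, probReal_univ] at h2
    have h3 : κ₁ * Real.pi ^ α ≤ κ₁ * r ^ α := by gcongr
    exact measureReal_le_one.trans (by linarith)

theorem IsDetectable.le_measureReal_closedBall {E : Type*} [MetricSpace E]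
    [MeasurableSpace E] {μ : Measure E} [IsProbabilityMeasure μ]
    {α κ₁ κ₂ r₀ : ℝ} (hμ : IsDetectable μ α κ₁ κ₂ r₀) {z : E} (hz : z ∈ μ.support) {r : ℝ}
    (hr : 0 < r) (hr' : r ≤ r₀) : κ₂ * r ^ α ≤ μ.real (Metric.closedBall z r) :=
  (ENNReal.ofReal_le_iff_le_toReal (measure_ne_top _ _)).1 (hμ.le_measure_closedBall z hz r hr hr')

theorem mainTheorem2
    (h : ℝ → ℝ) (hh : IsLowPassFilter h)
    (α κ₁ κ₂ r₀ S : ℝ) (hS : α < S) :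
    -- All constants depend only on the filter, the detectability parameters and `S`.
    ∃ A C c₁ c₂ a b : ℝ, 0 < A ∧ 0 < C ∧ C < 1 ∧ 0 < c₁ ∧ 0 < c₂ ∧ 0 < a ∧ 0 < b ∧
    ∃ r : ℝ → ℝ,
      (∀ Θ : ℝ, 0 < Θ → Θ < C →
        a * Θ ^ (-1 / (S - α)) ≤ r Θ ∧ r Θ ≤ b * Θ ^ (-1 / (S - α))) ∧
      ∀ (E : Type*) [MetricSpace E] [CompactSpace E] [MeasurableSpace E] [BorelSpace E],
        Metric.diam (Set.univ : Set E) = Real.pi →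
      ∀ (μ : Measure E) [IsProbabilityMeasure μ], IsDetectable μ α κ₁ κ₂ r₀ →
      ∀ Θ : ℝ, 0 < Θ → Θ < C →
      ∀ n M : ℕ, 1 ≤ n → 1 ≤ M → A * (n : ℝ) ^ α * Real.log n ≤ M →
      ∀ (Ω : Type*) [MeasurableSpace Ω] (P : Measure Ω) [IsProbabilityMeasure P]
        (x : Fin M → Ω → E),
        (∀ j, Measurable (x j)) → iIndepFun x P → (∀ j, P.map (x j) = μ) →
        ENNReal.ofReal (1 - c₁ / (M : ℝ) ^ c₂) ≤
          P {ω | μ.support ⊆ supportEstimatorSet h n (fun j => x j ω) Θ ∧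
            supportEstimatorSet h n (fun j => x j ω) Θ ⊆
              Metric.cthickening (r Θ / n) μ.support} := by
  -- For other parameters no measure is detectable, so arbitrary constants serve.
  by_cases hpar : 0 ≤ α ∧ 0 ≤ κ₁ ∧ 0 < κ₂ ∧ 0 < r₀
  swap
  · refine ⟨1, 1 / 2, 1, 1, 1, 1, by norm_num, by norm_num, by norm_num, by norm_num, by norm_num,
      by norm_num, by norm_num, fun Θ => Θ ^ (-1 / (S - α)), fun Θ _ _ => by simp, ?_⟩
    intro E _ _ _ _ _ μ _ hμ
    exact absurd ⟨hμ.exponent_nonneg, hμ.upper_const_nonneg, hμ.lower_const_pos, hμ.radius_pos⟩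
      hpar
  obtain ⟨hα, hκ₁, hκ₂, hr₀⟩ := hpar
  obtain ⟨D, hD, hker⟩ := hh.exists_localizedKernel_re_le S
  set κ : ℝ := κ₁ + 1
  have hκ : 0 < κ := by linarith
  -- The net scale is `δ / n`: `δ ≤ 1 / 2` puts balls of radius `2 * δ / n` where the kernel is
  -- large, and `δ ≤ r₀` allows the lower measure bound.
  set δ : ℝ := min (1 / 2) r₀
  have hδ : 0 < δ := lt_min (by norm_num) hr₀
  have hδ2 : δ ≤ 1 / 2 := min_le_left _ _
  have hδr : δ ≤ r₀ := min_le_right _ _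
  -- The constant of the uniform upper count at `r = t / n`, `ε = δ / n`, after `δ ^ α` cancels.
  set B : ℝ := 3 * κ ^ 2 / κ₂ * 9 ^ α with hB
  have hB0 : 0 < B := by positivity
  set b₀ : ℝ := κ₂ * δ ^ α / 4 with hb₀
  have hb₀0 : 0 < b₀ := by positivity
  set G : ℝ := 2 ^ α / (1 - 2 ^ (-(S - α)))
  have hG0 : 0 < G := div_pos (by positivity) (by
    linarith [Real.rpow_lt_one_of_one_lt_of_neg (x := (2 : ℝ)) one_lt_two
      (by linarith : -(S - α) < 0)])
  -- With `R = ρ * Θ ^ (-1 / (S - α))` one has `R ^ (-(S - α)) = ρ ^ (-(S - α)) * Θ`, so a single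
  -- `ρ` serves every `Θ`.
  obtain ⟨ρ, hρ1, hρ⟩ : ∃ ρ : ℝ, 1 ≤ ρ ∧ D * B * (1 + G) * ρ ^ (-(S - α)) < b₀ / 4 := by
    have hlim := (tendsto_rpow_neg_atTop (sub_pos.2 hS)).const_mul (D * B * (1 + G))
    rw [mul_zero] at hlim
    exact ((Filter.eventually_ge_atTop 1).and
      (hlim.eventually (gt_mem_nhds (by positivity : 0 < b₀ / 4)))).exists
  have hρ0 : 0 < ρ := by linarith
  -- The `+ 1` keeps `A` positive when `α = 0`; the second entry of the minimum is the threshold for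
  -- the first inclusion.
  refine ⟨4 * α / b₀ + 1, min (1 / 2) (b₀ / 4 / (D * B * (2 + G))),
    2 / (κ₂ * (δ / 3) ^ α) * (2 / b₀), 1, ρ, ρ, by positivity, by positivity,
    (min_le_left _ _).trans_lt (by norm_num), by positivity, one_pos, hρ0, hρ0,
    fun Θ => ρ * Θ ^ (-1 / (S - α)), fun _ _ _ => ⟨le_rfl, le_rfl⟩, ?_⟩
  intro E _ _ _ _ hdiam μ _ hμ Θ hΘ hΘC n M hn hM hnM Ω _ P _ x hx hind hmap
  have hn0 : (0 : ℝ) < n := by exact_mod_cast hn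
  have hn1 : (1 : ℝ) ≤ n := by exact_mod_cast hn
  have hM0 : (0 : ℝ) < M := by exact_mod_cast hM
  have hdist : ∀ y z : E, dist y z ≤ Real.pi := fun y z => by
    rw [← hdiam]
    exact Metric.dist_le_diam_of_mem Metric.isBounded_of_compactSpace trivial trivial
  have hε0 : 0 < δ / n := by positivity
  have hbound := measureReal_compl_counts_le hκ.le hκ₂ hε0
    ((div_le_self hδ.le hn1).trans hδr)
    (fun z r hr => hμ.measureReal_closedBall_le hdist z hr)
    (fun z hz r hr hr' => hμ.le_measureReal_closedBall hz hr hr') hx hind hmap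
  have hscale : ∀ c : ℝ, 0 ≤ c → (c / n) ^ α = c ^ α * (n : ℝ) ^ (-α) := fun c hc => by
    rw [Real.div_rpow hc hn0.le, Real.rpow_neg hn0.le, div_eq_mul_inv]
  set good : Set Ω := {ω | (∀ j, x j ω ∈ μ.support) ∧
      (∀ z : E, ∀ r : ℝ, δ / n ≤ r →
        ((Finset.univ.filter fun j => dist z (x j ω) ≤ r).card : ℝ) ≤
        κ / κ₂ * (9 * r / (δ / n)) ^ α * (3 * (M * (κ * (δ / n) ^ α)))) ∧
      ∀ z ∈ μ.support, M * (κ₂ * (δ / n) ^ α) / 4 ≤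
        ((Finset.univ.filter fun j => dist z (x j ω) ≤ 2 * (δ / n)).card : ℝ)}
  have hfail : P.real goodᶜ ≤ 2 / (κ₂ * (δ / 3) ^ α) * (2 / b₀) / (M : ℝ) ^ (1 : ℝ) := by
    refine hbound.trans ?_
    rw [Real.rpow_one, le_div_iff₀ hM0]
    calc _ = 2 / (κ₂ * (δ / 3) ^ α) *
          ((n : ℝ) ^ α * M * Real.exp (-(b₀ * (M * (n : ℝ) ^ (-α))))) := by
          have e1 : δ / n / 3 = δ / 3 / n := by ring
          have e2 : (M : ℝ) * (κ₂ * (δ / n) ^ α) / 4 = b₀ * (M * (n : ℝ) ^ (-α)) := by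
            rw [hscale δ hδ.le, hb₀]; ring
          rw [e1, e2, hscale (δ / 3) (by positivity), Real.rpow_neg hn0.le]
          field_simp
      _ ≤ _ := by gcongr; exact rpow_mul_mul_exp_le hb₀0 hn hnM
  have hsub : good ⊆ {ω | μ.support ⊆ supportEstimatorSet h n (fun j => x j ω) Θ ∧
      supportEstimatorSet h n (fun j => x j ω) Θ ⊆
        Metric.cthickening (ρ * Θ ^ (-1 / (S - α)) / n) μ.support} := by
    rintro ω ⟨hω1, hω2, hω3⟩
    have hnα : 0 < (n : ℝ) ^ (-α) := by positivity
    have hR1 : 1 ≤ Θ ^ (-1 / (S - α)) := by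
      refine Real.one_le_rpow_of_pos_of_le_one_of_nonpos hΘ
        (hΘC.le.trans ((min_le_left _ _).trans (by norm_num))) ?_
      exact div_nonpos_of_nonpos_of_nonneg (by norm_num) (by linarith)
    refine hh.supportEstimatorSet_inclusions (α := α) (S := S) (D := D) (β := B * (n : ℝ) ^ (-α))
      (γ := b₀ * (n : ℝ) ^ (-α)) hn hM hα hS hD.le (by positivity) hω1
      (fun y z => hker E n hn y z (hdist y z)) (fun z t ht => ?_) (fun z hz => ?_) hΘ
      (one_le_mul_of_one_le_of_one_le hρ1 hR1) ?_ ?_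
    · have h1 := hω2 z (t / n) (by gcongr; linarith)
      have e : κ / κ₂ * (9 * (t / n) / (δ / n)) ^ α * (3 * (M * (κ * (δ / n) ^ α))) =
          B * (n : ℝ) ^ (-α) * M * t ^ α := by
        have ht0 : 0 ≤ t := by linarith
        rw [show 9 * (t / n) / (δ / n) = 9 * t / δ by field_simp, hscale δ hδ.le,
          Real.div_rpow (by positivity) hδ.le, Real.mul_rpow (by norm_num) ht0, hB]
        field_simp
      rw [e] at h1
      simpa only [le_div_iff₀ hn0, mul_comm] using h1
    · have h1 := hω3 z hz
      have e : (M : ℝ) * (κ₂ * (δ / n) ^ α) / 4 = b₀ * (n : ℝ) ^ (-α) * M := by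
        rw [hscale δ hδ.le, hb₀]; ring
      rw [e] at h1
      refine h1.trans (Nat.cast_le.2 (Finset.card_le_card fun j hj => ?_))
      simp only [Finset.mem_filter, Finset.mem_univ, true_and] at hj ⊢
      calc n * dist z (x j ω) ≤ n * (2 * (δ / n)) := by gcongr
        _ = 2 * δ := by field_simp
        _ ≤ 1 := by linarith
    · have h1 : Θ * (D * B * (2 + G)) ≤ b₀ / 4 :=
        (le_div_iff₀ (by positivity)).1 (hΘC.le.trans (min_le_right _ _))
      calc Θ * (D * (B * (n : ℝ) ^ (-α)) * (2 + G)) = Θ * (D * B * (2 + G)) * (n : ℝ) ^ (-α) := by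
            ring
        _ ≤ b₀ / 4 * (n : ℝ) ^ (-α) := by gcongr
        _ = _ := by ring
    · have e : (ρ * Θ ^ (-1 / (S - α))) ^ (-(S - α)) = ρ ^ (-(S - α)) * Θ := by
        rw [Real.mul_rpow hρ0.le (by positivity), ← Real.rpow_mul hΘ.le]
        have : S - α ≠ 0 := by linarith
        rw [show -1 / (S - α) * -(S - α) = 1 by field_simp, Real.rpow_one]
      rw [e]
      calc _ = D * B * (1 + G) * ρ ^ (-(S - α)) * (Θ * (n : ℝ) ^ (-α)) := by ring
        _ < b₀ / 4 * (Θ * (n : ℝ) ^ (-α)) := by gcongr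
        _ = _ := by ring
  rw [ENNReal.ofReal_le_iff_le_toReal (measure_ne_top _ _)]
  have h1 := measureReal_union_le (μ := P) good goodᶜ
  rw [Set.union_compl_self, probReal_univ] at h1
  calc _ ≤ P.real good := by linarith
    _ ≤ _ := measureReal_mono hsub
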